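/- Let $p$ be a prime and let $k$ be a field of characteristic $p$ of finite degree of imperfection $r > 0$; that is, $k$ has a $p$-basis $\lambda_1, \dots, \lambda_r$, meaning that the monomials $\prod_{i=1}^r \lambda_i^{f(i)}$ with $0 \le f(i) < p$ form a basis of $k$ over $k^p$. A $p$-polynomial over $k$ is a polynomial of the form $\sum_{i=1}^n \sum_{j} c_{i,j} X_i^{p^j} \in k[X_1, \dots, X_n]$ (a finite sum with $c_{i,j} \in k$). Let $P, L \in k[X_1, \dots, X_{p^r}]$ be $p$-polynomials such that $P$ is homogeneous of degree $p$ and universal, i.e. the map $k^{p^r} \to k$, $x \mapsto P(x)$, is surjective, and such that $L$ is homogeneous of degree $1$ and nonzero. Let $\mathscr{V}_{P,L} := \{P + L = 0\} \subset \mathbf{G}_{\mathrm{a}}^{p^r}$, a commutative $k$-group scheme under addition of coordinates. Then the ring $\operatorname{End}(\mathscr{V}_{P,L})$ of endomorphisms of the $k$-group scheme $\mathscr{V}_{P,L}$ (with pointwise addition, and composition as multiplication) is isomorphic to $\mathbf{F}_p$; that is, every endomorphism is multiplication by a unique element of $\mathbf{F}_p$. -/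

import Mathlib

open CategoryTheory AlgebraicGeometry MvPolynomial Opposite

universe u

noncomputable section

/-! ### The degree of imperfection -/

/-- `b = (b₁, …, bᵣ)` is a `p`-basis of the field `k` of characteristic `p`: the monomials
`∏ bᵢ ^ f(i)` with `0 ≤ f(i) < p` form a basis of `k` as a vector space over `kᵖ`. -/
def IsPBasis {k : Type u} [Field k] (p : ℕ) [Fact p.Prime] [CharP k p] {r : ℕ}
    (b : Fin r → k) : Prop :=
  LinearIndependent (frobenius k p).fieldRange
      (fun f : Fin r → Fin p => ∏ i, b i ^ (f i : ℕ)) ∧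
    Submodule.span (frobenius k p).fieldRange
      (Set.range fun f : Fin r → Fin p => ∏ i, b i ^ (f i : ℕ)) = ⊤

/-- `k` has (finite) degree of imperfection `r`: it has a `p`-basis with `r` elements. -/
def HasDegreeOfImperfection (k : Type u) [Field k] (p : ℕ) [Fact p.Prime] [CharP k p]
    (r : ℕ) : Prop :=
  ∃ b : Fin r → k, IsPBasis p b

/-! ### `p`-polynomials -/

/-- `F ∈ k[X₁, …, Xₙ]` is a `p`-polynomial: `F = ∑ i, ∑ j, c i j * Xᵢ ^ (p ^ j)`. -/
def IsPPolynomial {k : Type u} [Field k] (p : ℕ) {n : ℕ} (F : MvPolynomial (Fin n) k) : Prop :=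
  ∃ (N : ℕ) (c : Fin n → ℕ → k), F = ∑ i, ∑ j ∈ Finset.range N, C (c i j) * X i ^ (p ^ j)

/-- `P` is universal over `k`: the map `kⁿ → k` that it defines is surjective. -/
def IsUniversal {k : Type u} [Field k] {n : ℕ} (P : MvPolynomial (Fin n) k) : Prop :=
  Function.Surjective fun x : Fin n → k => eval x P

theorem IsPPolynomial.add {k : Type u} [Field k] {p n : ℕ} {F G : MvPolynomial (Fin n) k}
    (hF : IsPPolynomial p F) (hG : IsPPolynomial p G) : IsPPolynomial p (F + G) := by
  have key : ∀ (N M : ℕ) (c : Fin n → ℕ → k), N ≤ M →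
      ∑ i, ∑ j ∈ Finset.range N, C (c i j) * X i ^ (p ^ j) =
      ∑ i, ∑ j ∈ Finset.range M,
        (C (if j < N then c i j else 0) * X i ^ (p ^ j) : MvPolynomial (Fin n) k) := by
    intro N M c h
    refine Finset.sum_congr rfl fun i _ => ?_
    rw [← Finset.sum_subset (Finset.range_mono h)]
    · refine Finset.sum_congr rfl fun j hj => ?_
      rw [if_pos (Finset.mem_range.1 hj)]
    · intro j _ hj
      rw [if_neg (by simpa using hj)]
      simp
  obtain ⟨N, c, rfl⟩ := hF
  obtain ⟨M, d, rfl⟩ := hG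
  refine ⟨max N M, fun i j => (if j < N then c i j else 0) + (if j < M then d i j else 0), ?_⟩
  rw [key N (max N M) c (le_max_left _ _), key M (max N M) d (le_max_right _ _),
    ← Finset.sum_add_distrib]
  refine Finset.sum_congr rfl fun i _ => ?_
  rw [← Finset.sum_add_distrib]
  refine Finset.sum_congr rfl fun j _ => ?_
  rw [C_add, add_mul]

section Aeval

variable {k : Type u} [Field k] {p : ℕ} [Fact p.Prime] [CharP k p] {n : ℕ}
  {F : MvPolynomial (Fin n) k}

theorem IsPPolynomial.aeval_add (hF : IsPPolynomial p F) {R : Type u} [CommRing R] [Algebra k R]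
    (x y : Fin n → R) : aeval (x + y) F = aeval x F + aeval y F := by
  obtain ⟨N, c, rfl⟩ := hF
  rcases subsingleton_or_nontrivial R with h | h
  · exact Subsingleton.elim _ _
  have : CharP R p := charP_of_injective_algebraMap (algebraMap k R).injective p
  simp only [map_sum, map_mul, map_pow, aeval_X, algHom_C, Pi.add_apply, add_pow_char_pow,
    mul_add, Finset.sum_add_distrib]

theorem IsPPolynomial.aeval_zero (hF : IsPPolynomial p F) {R : Type u} [CommRing R]
    [Algebra k R] : aeval (0 : Fin n → R) F = 0 := by
  have := hF.aeval_add (0 : Fin n → R) 0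
  rw [add_zero] at this
  simpa using this

theorem IsPPolynomial.aeval_neg (hF : IsPPolynomial p F) {R : Type u} [CommRing R]
    [Algebra k R] (x : Fin n → R) : aeval (-x) F = -aeval x F := by
  have := hF.aeval_add x (-x)
  rw [add_neg_cancel, hF.aeval_zero] at this
  exact (neg_eq_of_add_eq_zero_right this.symm).symm

end Aeval

/-! ### The group scheme `{F = 0} ⊆ 𝔾ₐⁿ` -/

section VanishingGroup

variable {k : Type u} [Field k] (p : ℕ) [Fact p.Prime] [CharP k p] {n : ℕ}
  (F : MvPolynomial (Fin n) k) (hF : IsPPolynomial p F)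

/-- The subgroup `{x ∈ Rⁿ | F(x) = 0}` of `𝔾ₐⁿ(R) = Rⁿ`, for a `k`-algebra `R`. -/
def zeroSubgroup (R : Type u) [CommRing R] [Algebra k R] : AddSubgroup (Fin n → R) where
  carrier := {x | aeval x F = 0}
  zero_mem' := hF.aeval_zero
  add_mem' {x y} hx hy := by
    change aeval (x + y) F = 0
    rw [hF.aeval_add, show aeval x F = 0 from hx, show aeval y F = 0 from hy, add_zero]
  neg_mem' {x} hx := by
    change aeval (-x) F = 0
    rw [hF.aeval_neg, show aeval x F = 0 from hx, neg_zero]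

/-- The functor of points `R ↦ {x ∈ Rⁿ | F(x) = 0}` of `{F = 0} ⊆ 𝔾ₐⁿ` on `k`-algebras. Mathlib
writes the laws of group objects multiplicatively, hence the `Multiplicative`. -/
def pointsFunctor : CommAlgCat.{u} k ⥤ CommGrpCat.{u} where
  obj R := .of (Multiplicative (zeroSubgroup p F hF R))
  map {R S} φ := CommGrpCat.ofHom <| AddMonoidHom.toMultiplicative
    { toFun := fun x => ⟨fun i => φ.hom (x.1 i), by
        change aeval (fun i => φ.hom (x.1 i)) F = 0
        have h : φ.hom (aeval x.1 F) = aeval (fun i => φ.hom (x.1 i)) F :=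
          (comp_aeval_apply x.1 φ.hom F)
        rw [← h, show aeval x.1 F = 0 from x.2, map_zero]⟩
      map_zero' := by ext i; exact map_zero φ.hom
      map_add' := fun x y => by ext i; exact map_add φ.hom _ _ }

/-- The coordinate ring `k[X₁, …, Xₙ] / (F)` of `{F = 0}`. -/
abbrev coordRing : Type u := MvPolynomial (Fin n) k ⧸ Ideal.span {F}

/-- `k`-algebra homomorphisms `k[X₁, …, Xₙ] / (F) → R` are the points `x ∈ Rⁿ` with `F(x) = 0`. -/
def coordRingHomEquiv (R : Type u) [CommRing R] [Algebra k R] :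
    (coordRing F →ₐ[k] R) ≃ zeroSubgroup p F hF R where
  toFun φ := ⟨fun i => φ (Ideal.Quotient.mk _ (X i)), by
    change aeval (fun i => φ (Ideal.Quotient.mk _ (X i))) F = 0
    have h : (φ.comp (Ideal.Quotient.mkₐ k (Ideal.span {F}))) =
        aeval (fun i => φ (Ideal.Quotient.mk _ (X i))) := by
      ext i; simp
    rw [← h]
    have h0 : Ideal.Quotient.mkₐ k (Ideal.span {F}) F = 0 :=
      Ideal.Quotient.eq_zero_iff_mem.2 (Ideal.mem_span_singleton_self F)
    rw [AlgHom.comp_apply, h0, map_zero]⟩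
  invFun x := Ideal.Quotient.liftₐ _ (aeval x.1) fun a ha => by
    obtain ⟨b, rfl⟩ := Ideal.mem_span_singleton'.1 ha
    rw [map_mul, show aeval x.1 F = 0 from x.2, mul_zero]
  left_inv φ := by
    refine Ideal.Quotient.algHom_ext _ ?_
    ext i
    exact aeval_X _ i
  right_inv x := by
    ext i
    exact aeval_X _ i

/-- The coordinate ring represents the functor of points. -/
def coordRingRepresentableBy :
    ((unopUnop (CommAlgCat.{u} k) ⋙ pointsFunctor p F hF) ⋙ forget CommGrpCat).RepresentableBy
      (op (CommAlgCat.of k (coordRing F))) where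
  homEquiv {R} :=
    { toFun := fun φ => Multiplicative.ofAdd (coordRingHomEquiv p F hF R.unop φ.unop.hom)
      invFun := fun x =>
        (CommAlgCat.ofHom ((coordRingHomEquiv p F hF R.unop).symm (Multiplicative.toAdd x))).op
      left_inv := fun φ => Quiver.Hom.unop_inj <| CommAlgCat.hom_ext <|
        (coordRingHomEquiv p F hF R.unop).symm_apply_apply φ.unop.hom
      right_inv := fun x => (coordRingHomEquiv p F hF R.unop).apply_symm_apply (Multiplicative.toAdd x) }
  homEquiv_comp _ _ := rfl

/-- The coordinate ring, as a commutative group object of the opposite of the category of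
`k`-algebras; its group law is addition of points. -/
def affineVanishingGroup : CommGrp (CommAlgCat.{u} k)ᵒᵖ :=
  letI := CommGrpObj.ofRepresentableBy _ (unopUnop _ ⋙ pointsFunctor p F hF)
    (coordRingRepresentableBy p F hF)
  ⟨op (CommAlgCat.of k (coordRing F))⟩

/-- `Spec` as a functor from `k`-algebras to schemes over `Spec k`. -/
def specFunctor (k : Type u) [Field k] : (CommAlgCat.{u} k)ᵒᵖ ⥤ Over (Spec (.of k)) :=
  algSpec (.of k)

instance specFunctorBraided (k : Type u) [Field k] : (specFunctor k).Braided :=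
  braidedAlgSpec (R := .of k)

/-- The commutative `k`-group scheme `{F = 0} ⊆ 𝔾ₐⁿ`, for a `p`-polynomial `F`: the scheme
`Spec k[X₁, …, Xₙ] / (F)` over `Spec k`, with addition of points as its group law. -/
def vanishingGroup : CommGrp (Over (Spec (.of k))) :=
  (specFunctor k).mapCommGrp.obj (affineVanishingGroup p F hF)

end VanishingGroup

/-- The `k`-group scheme `𝒱_{P, L} = {P + L = 0} ⊆ 𝔾ₐⁿ`. -/
def groupV {k : Type u} [Field k] (p : ℕ) [Fact p.Prime] [CharP k p] {n : ℕ}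
    (P L : MvPolynomial (Fin n) k) (hP : IsPPolynomial p P) (hL : IsPPolynomial p L) :
    CommGrp (Over (Spec (.of k))) :=
  vanishingGroup p (P + L) (hP.add hL)

/-! ### The endomorphism ring of a commutative group object -/

section EndRing

open CategoryTheory.MonObj

universe v w

variable {C : Type w} [Category.{v} C] [CartesianMonoidalCategory C] [BraidedCategory C]

/-- The endomorphisms of a commutative group object, in the category of group objects; written
additively. -/
def EndRing (G : CommGrp C) : Type v := Additive (G.toGrp ⟶ G.toGrp)

/-- The endomorphism ring of a commutative group object: endomorphisms are added pointwise, through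
the group law of `G`, and multiplied by composition. -/
instance (G : CommGrp C) : Ring (EndRing G) where
  __ := (inferInstance : AddCommGroup (Additive (G.toGrp ⟶ G.toGrp)))
  mul f g := Additive.ofMul (g.toMul ≫ f.toMul)
  one := Additive.ofMul (𝟙 G.toGrp)
  mul_assoc f g h := congrArg Additive.ofMul (Category.assoc _ _ _).symm
  one_mul f := congrArg Additive.ofMul (Category.comp_id _)
  mul_one f := congrArg Additive.ofMul (Category.id_comp _)
  left_distrib f g h := congrArg Additive.ofMul
    (MonObj.mul_comp (C := Grp C) (Additive.toMul g) (Additive.toMul h) (Additive.toMul f))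
  right_distrib f g h := congrArg Additive.ofMul
    (MonObj.comp_mul (C := Grp C) (Additive.toMul h) (Additive.toMul f) (Additive.toMul g))
  zero_mul f := congrArg Additive.ofMul
    (MonObj.comp_one (C := Grp C) (Additive.toMul f))
  mul_zero f := congrArg Additive.ofMul
    (MonObj.one_comp (C := Grp C) (Additive.toMul f))

end EndRing

end

/-! Write `F = P + L = ∑ aᵢ Xᵢᵖ + ∑ lᵢ Xᵢ`. Universality says that the `aᵢ` span `k` over `kᵖ`;
there are `pʳ = [k : kᵖ]` of them, so they form a basis. Hence `P` has only the trivial zero and,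
being additive, is injective on points over `k`.

By Yoneda an endomorphism is a tuple of polynomials modulo `F`. As `a₀ ≠ 0`, `F` is monic of degree
`p` in `X₀` up to a unit, so representatives `fᵢ` of `X₀`-degree less than `p` exist. A polynomial
of `X₀`-degree less than `p` that vanishes modulo `F` is zero; this makes `f` additive on the whole
affine space (`aeval_add_of_vanishing`) and gives `F ∘ f = g F` with `g ∈ k`
(`exists_aeval_comp_eq_mul`).

On a line `T ↦ cT`, anisotropy of `P` forbids cancellation of leading terms, so `f(cT) = e(c) T`
with `P(e(c)) = g P(c)` and `L(e(c)) = g L(c)`. Iterating `p` times, `P(eᵖ(c)) = gᵖ P(c) = P(gc)`,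
so `eᵖ(c) = gc`; applying `L ≠ 0` gives `gᵖ = g`. Then `P(e(c)) = P(gc)`, so `e(c) = gc`, and `f` is
multiplication by `g ∈ 𝐅ₚ` (`exists_eq_C_mul_X`). -/

/-! ### Endomorphisms of group objects and of functors of points -/

section EndRing
universe v w v' w'

open CategoryTheory.MonObj

variable {C : Type w} [Category.{v} C] [CartesianMonoidalCategory C] [BraidedCategory C]
  {D : Type w'} [Category.{v'} D] [CartesianMonoidalCategory D] [BraidedCategory D]

/-- A fully faithful braided functor induces an isomorphism of endomorphism rings of commutative
group objects. -/
noncomputable def EndRing.mapEquiv (S : C ⥤ D) [S.Braided] (hS : S.FullyFaithful) (G : CommGrp C) :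
    EndRing G ≃+* EndRing (S.mapCommGrp.obj G) where
  toEquiv := (Additive.toMul.trans (hS.mapGrp.homEquiv)).trans Additive.ofMul
  map_mul' f g := congrArg Additive.ofMul (S.mapGrp.map_comp g.toMul f.toMul)
  map_add' f g := congrArg Additive.ofMul <| Grp.hom_ext _ _ <|
    Functor.map_mul S f.toMul.hom.hom g.toMul.hom.hom

end EndRing

/-! ### Endomorphisms as polynomial maps on points -/

section Points

open scoped CategoryTheory.MonObj

variable {k : Type u} [Field k] (p : ℕ) [Fact p.Prime] [CharP k p] {n : ℕ}
  (F : MvPolynomial (Fin n) k) (hF : IsPPolynomial p F)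

/-- The group law was defined by transport along the representing bijection, so the Yoneda
isomorphism is multiplicative, and its components are `coordRingHomEquiv` by definition. -/
theorem affineVanishingGroup_homEquiv_mul {R : (CommAlgCat.{u} k)ᵒᵖ}
    (x y : R ⟶ (affineVanishingGroup p F hF).X) :
    coordRingHomEquiv p F hF R.unop (x * y).unop.hom =
      coordRingHomEquiv p F hF R.unop x.unop.hom + coordRingHomEquiv p F hF R.unop y.unop.hom := by
  have h := ((yonedaMonObjIsoOfRepresentableBy _ ((unopUnop _ ⋙ pointsFunctor p F hF) ⋙
    forget₂ CommGrpCat GrpCat ⋙ forget₂ GrpCat MonCat) (coordRingRepresentableBy p F hF)).hom.app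
      (op R)).hom.map_mul x y
  exact h

/-- The endomorphism of the coordinate ring given by an endomorphism of `{F = 0}`. -/
noncomputable def endComorphism (f : EndRing (affineVanishingGroup p F hF)) :
    coordRing F →ₐ[k] coordRing F :=
  f.toMul.hom.hom.unop.hom

/-- The image of the generic point of `{F = 0}` under an endomorphism. -/
noncomputable def endPoint :
    EndRing (affineVanishingGroup p F hF) →+ zeroSubgroup p F hF (coordRing F) :=
  AddMonoidHom.mk' (fun f => coordRingHomEquiv p F hF _ (endComorphism p F hF f)) fun f g =>
    affineVanishingGroup_homEquiv_mul p F hF f.toMul.hom.hom g.toMul.hom.hom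

theorem endPoint_injective : Function.Injective (endPoint p F hF) := fun _ _ h =>
  Additive.toMul.injective <| Grp.hom_ext _ _ <| Quiver.Hom.unop_inj <| CommAlgCat.hom_ext <|
    (coordRingHomEquiv p F hF _).injective h

theorem endPoint_one (i : Fin n) : (endPoint p F hF 1).1 i = Ideal.Quotient.mk _ (X i) := rfl

variable {R : Type u} [CommRing R] [Algebra k R]

/-- A point of `{F = 0}`, as a morphism in the opposite of the category of `k`-algebras. -/
noncomputable def pointHom (w : zeroSubgroup p F hF R) :
    op (CommAlgCat.of k R) ⟶ (affineVanishingGroup p F hF).X :=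
  (CommAlgCat.ofHom ((coordRingHomEquiv p F hF R).symm w)).op

/-- A morphism to `{F = 0}` in the opposite of the category of `k`-algebras, as a point. -/
noncomputable def homPoint (x : op (CommAlgCat.of k R) ⟶ (affineVanishingGroup p F hF).X) :
    zeroSubgroup p F hF R :=
  coordRingHomEquiv p F hF R x.unop.hom

theorem homPoint_pointHom (w : zeroSubgroup p F hF R) :
    homPoint p F hF (pointHom p F hF w) = w :=
  (coordRingHomEquiv p F hF R).apply_symm_apply w

theorem homPoint_injective : Function.Injective (homPoint p F hF (R := R)) := fun _ _ h =>
  Quiver.Hom.unop_inj <| CommAlgCat.hom_ext <| (coordRingHomEquiv p F hF R).injective h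

theorem homPoint_mul (x y : op (CommAlgCat.of k R) ⟶ (affineVanishingGroup p F hF).X) :
    homPoint p F hF (x * y) = homPoint p F hF x + homPoint p F hF y :=
  affineVanishingGroup_homEquiv_mul p F hF x y

theorem pointHom_add (v w : zeroSubgroup p F hF R) :
    pointHom p F hF (v + w) = pointHom p F hF v * pointHom p F hF w :=
  homPoint_injective p F hF <| by simp only [homPoint_mul, homPoint_pointHom]

/-- Every point is a specialization of the generic one, so any polynomials lifting the image of the
generic point compute the endomorphism on all points. -/
theorem homPoint_comp (f : EndRing (affineVanishingGroup p F hF))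
    {g : Fin n → MvPolynomial (Fin n) k}
    (hg : ∀ i, (endPoint p F hF f).1 i = Ideal.Quotient.mk _ (g i))
    (w : zeroSubgroup p F hF R) (i : Fin n) :
    (homPoint p F hF (pointHom p F hF w ≫ f.toMul.hom.hom)).1 i = aeval w.1 (g i) := by
  change (coordRingHomEquiv p F hF R).symm w ((endPoint p F hF f).1 i) = _
  rw [hg]
  rfl

/-- An endomorphism of `{F = 0}` acts additively on points. -/
theorem endPoint_add (f : EndRing (affineVanishingGroup p F hF))
    {g : Fin n → MvPolynomial (Fin n) k}
    (hg : ∀ i, (endPoint p F hF f).1 i = Ideal.Quotient.mk _ (g i))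
    {y z : Fin n → R} (hy : aeval y F = 0) (hz : aeval z F = 0) (i : Fin n) :
    aeval (y + z) (g i) = aeval y (g i) + aeval z (g i) := by
  let v : zeroSubgroup p F hF R := ⟨y, hy⟩
  let w : zeroSubgroup p F hF R := ⟨z, hz⟩
  have h := MonObj.mul_comp (pointHom p F hF v) (pointHom p F hF w) f.toMul.hom.hom
  rw [← pointHom_add] at h
  have h' := congrArg (fun t => (homPoint p F hF t).1 i) h
  simp only [homPoint_mul, AddSubgroup.coe_add, Pi.add_apply, homPoint_comp p F hF f hg] at h'
  exact h'

end Points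

/-! ### The polynomials `∑ aᵢ Xᵢᵖ + ∑ lᵢ Xᵢ` and their restriction to lines -/

section FrobLinear

variable {σ : Type*} {k : Type u} [Field k]

theorem aeval_C_comp {R : Type*} [CommRing R] [Algebra k R] (w : σ → R) (f : MvPolynomial σ k) :
    aeval (fun i => Polynomial.C (w i)) f = Polynomial.C (aeval w f) :=
  aeval_algebraMap_apply (Polynomial R) w f

/-- The generic point of the line through `w` in the direction of the coordinate `i₀`. -/
noncomputable def lineThrough [DecidableEq σ] {R : Type*} [CommRing R] (i₀ : σ) (w : σ → R) :
    σ → Polynomial R :=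
  Pi.single (M := fun _ => Polynomial R) i₀ Polynomial.X + fun i => Polynomial.C (w i)

theorem lineThrough_add [DecidableEq σ] {R : Type*} [CommRing R] (i₀ : σ) (w z : σ → R) :
    lineThrough i₀ (w + z) = lineThrough i₀ w + fun i => Polynomial.C (z i) := by
  funext i
  simp [lineThrough, add_assoc]

variable [Fintype σ] (p : ℕ)

/-- The polynomial `∑ aᵢ Xᵢᵖ + ∑ lᵢ Xᵢ`. -/
noncomputable def frobLinear (a l : σ → k) : MvPolynomial σ k :=
  ∑ i, C (a i) * X i ^ p + ∑ i, C (l i) * X i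

theorem aeval_frobLinear (a l : σ → k) {R : Type*} [CommRing R] [Algebra k R] (y : σ → R) :
    aeval y (frobLinear p a l) =
      ∑ i, algebraMap k R (a i) * y i ^ p + ∑ i, algebraMap k R (l i) * y i := by
  simp [frobLinear]

theorem isPPolynomial_frobLinear {n : ℕ} (a l : Fin n → k) :
    IsPPolynomial p (frobLinear p a l) :=
  ⟨2, fun i j => if j = 0 then l i else a i, by
    simp [frobLinear, Finset.sum_range_succ, Finset.sum_add_distrib, add_comm]⟩

variable {p} [DecidableEq σ]

/-- Along the line only the coordinate `i₀` involves the variable, and it does so with degree at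
most `1`. -/
theorem natDegree_aeval_lineThrough_le {R : Type*} [CommRing R] [Algebra k R]
    (i₀ : σ) (w : σ → R) (f : MvPolynomial σ k) :
    (aeval (lineThrough i₀ w) f).natDegree ≤ degreeOf i₀ f := by
  rw [aeval_def, eval₂_eq']
  refine Polynomial.natDegree_sum_le_of_forall_le _ _ fun d hd => ?_
  refine (Polynomial.natDegree_C_mul_le (algebraMap k R (coeff d f)) _).trans ?_
  refine (Polynomial.natDegree_prod_le _ _).trans ?_
  rw [Finset.sum_eq_single i₀]
  · refine (Polynomial.natDegree_pow_le.trans (Nat.mul_le_mul_left _ (m := 1) ?_)).trans ?_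
    · simp only [lineThrough, Pi.add_apply, Pi.single_eq_same]
      compute_degree
    · simpa using monomial_le_degreeOf i₀ hd
  · intro i _ hi
    rw [lineThrough, Pi.add_apply, Pi.single_eq_of_ne hi, zero_add, ← Polynomial.C_pow,
      Polynomial.natDegree_C]
  · simp

theorem aeval_single_frobLinear (hp : p ≠ 0) (a l : σ → k) {R : Type*} [CommRing R] [Algebra k R]
    (i : σ) (x : R) :
    aeval (Pi.single i x) (frobLinear p a l) =
      algebraMap k R (a i) * x ^ p + algebraMap k R (l i) * x := by
  rw [aeval_frobLinear, Finset.sum_eq_single i, Finset.sum_eq_single i]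
  · simp
  all_goals simp +contextual [hp]

end FrobLinear

/-! ### Extending additivity from `{F = 0}` to affine space -/

section Core

variable {k : Type u} [Field k] {p : ℕ} [Fact p.Prime] [CharP k p] {n : ℕ}
  {a l : Fin (n + 1) → k}

/-- `F` restricted to a line in the direction of the coordinate `0` does not divide a nonzero
polynomial of degree less than `p`. -/
theorem eq_zero_of_aeval_lineThrough_dvd (ha : a 0 ≠ 0) {A : Type u} [CommRing A] [Algebra k A]
    (w : Fin (n + 1) → A) {q : Polynomial A} (hq : q.natDegree < p)
    (h : aeval (lineThrough 0 w) (frobLinear p a l) ∣ q) : q = 0 := by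
  rcases subsingleton_or_nontrivial A with hA | hA
  · exact Subsingleton.elim _ _
  have hp : 1 < p := (Fact.out : p.Prime).one_lt
  rw [lineThrough, (isPPolynomial_frobLinear p a l).aeval_add,
    aeval_single_frobLinear (by omega), aeval_C_comp] at h
  -- Splitting off the unit `a₀` leaves a monic polynomial of degree `p`, so the degree argument
  -- works even if `A` has zero divisors.
  have e : algebraMap k (Polynomial A) (a 0) * Polynomial.X ^ p +
      algebraMap k (Polynomial A) (l 0) * Polynomial.X +
      Polynomial.C (aeval w (frobLinear p a l)) =
      algebraMap k (Polynomial A) (a 0) * (Polynomial.X ^ p +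
        (Polynomial.C (algebraMap k A (l 0 * (a 0)⁻¹)) * Polynomial.X +
          Polynomial.C (algebraMap k A (a 0)⁻¹ * aeval w (frobLinear p a l)))) := by
    have h1 : Polynomial.C (algebraMap k A (a 0)) * Polynomial.C (algebraMap k A (a 0)⁻¹) = 1 := by
      rw [← map_mul, ← map_mul, mul_inv_cancel₀ ha, map_one, map_one]
    simp only [map_mul, Polynomial.algebraMap_apply]
    linear_combination (-Polynomial.C (aeval w (frobLinear p a l)) -
      Polynomial.C (algebraMap k A (l 0)) * Polynomial.X) * h1
  rw [e] at h
  by_contra hne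
  have hdeg := (Polynomial.natDegree_linear_le (a := algebraMap k A (l 0 * (a 0)⁻¹))
    (b := algebraMap k A (a 0)⁻¹ * aeval w (frobLinear p a l))).trans_lt hp
  refine (Polynomial.monic_X_pow_add (Polynomial.degree_linear_le.trans_lt
    (by exact_mod_cast hp))).not_dvd_of_natDegree_lt hne ?_ ((dvd_mul_left _ _).trans h)
  rwa [Polynomial.natDegree_add_eq_left_of_natDegree_lt, Polynomial.natDegree_X_pow]
  rwa [Polynomial.natDegree_X_pow]

/-- Additivity of a polynomial of degree less than `p` in the coordinate `0` extends from
`{F = 0}` to the affine space. -/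
theorem aeval_add_of_vanishing (ha : a 0 ≠ 0) {f : MvPolynomial (Fin (n + 1)) k}
    (hf : degreeOf 0 f < p) {A : Type u} [CommRing A] [Algebra k A] (z : Fin (n + 1) → A)
    (h : ∀ (R : Type u) [CommRing R] [Algebra k R] (φ : A →ₐ[k] R) (y : Fin (n + 1) → R),
      aeval y (frobLinear p a l) = 0 →
        aeval (y + fun i => φ (z i)) f = aeval y f + aeval (fun i => φ (z i)) f)
    (y : Fin (n + 1) → A) : aeval (y + z) f = aeval y f + aeval z f := by
  -- The line through `w` passes through `y` at parameter `y 0`; `q` is the additivity defect along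
  -- it.
  let w := Function.update y 0 0
  let q : Polynomial A := aeval (lineThrough 0 (w + z)) f - aeval (lineThrough 0 w) f -
    Polynomial.C (aeval z f)
  have hq : q = 0 := by
    refine eq_zero_of_aeval_lineThrough_dvd ha (l := l) w ?_ ?_
    · refine (Polynomial.natDegree_sub_le_of_le (Polynomial.natDegree_sub_le_of_le
        (natDegree_aeval_lineThrough_le 0 _ f) (natDegree_aeval_lineThrough_le 0 _ f))
        (Polynomial.natDegree_C _).le).trans_lt ?_
      simpa using hf
    -- Modulo the restriction of `F`, the generic point of the line lies on `{F = 0}`, so `h`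
    -- applies there.
    · let I := Ideal.span {aeval (lineThrough 0 w) (frobLinear p a l)}
      let π : Polynomial A →ₐ[k] Polynomial A ⧸ I := Ideal.Quotient.mkₐ k I
      have hY : aeval (fun i => π (lineThrough 0 w i)) (frobLinear p a l) = 0 := by
        rw [← comp_aeval_apply]
        exact Ideal.Quotient.eq_zero_iff_mem.2 (Ideal.mem_span_singleton_self _)
      have h1 := h _ (π.comp (Algebra.algHom k A (Polynomial A))) _ hY
      have h2 : π (aeval (lineThrough 0 (w + z)) f) =
          π (aeval (lineThrough 0 w) f) + π (Polynomial.C (aeval z f)) := by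
        rw [lineThrough_add, ← aeval_C_comp, comp_aeval_apply, comp_aeval_apply, comp_aeval_apply]
        simp only [Pi.add_apply, map_add]
        exact h1
      rw [← Ideal.mem_span_singleton, ← Ideal.Quotient.eq_zero_iff_mem]
      change π q = 0
      simp only [q, map_sub, h2]
      ring
  have hw (v : Fin (n + 1) → A) :
      (fun i => Polynomial.evalRingHom (y 0) (lineThrough 0 (w + v) i)) = y + v := by
    funext i
    by_cases hi : i = 0
    · subst hi; simp [lineThrough, w]
    · simp [lineThrough, w, hi]
  let ev : Polynomial A →ₐ[k] A := (Polynomial.aeval (R := A) (y 0)).restrictScalars k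
  have hev (v : Fin (n + 1) → A) : ev (aeval (lineThrough 0 (w + v)) f) = aeval (y + v) f := by
    rw [comp_aeval_apply, ← hw]
    rfl
  have h3 := hev 0
  simp only [add_zero] at h3
  have h4 := congrArg ev hq
  have h5 : ev (Polynomial.C (aeval z f)) = aeval z f := Polynomial.aeval_C _ _
  simp only [q, map_sub, hev, h3, h5, map_zero] at h4
  linear_combination h4

/-- Additive polynomials of degree less than `p` are linear. -/
theorem eq_C_mul_X_of_additive {k : Type u} [Field k] {p : ℕ} [CharP k p] {u : Polynomial k}
    (hu : u.natDegree < p)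
    (h : ∀ (R : Type u) [CommRing R] [Algebra k R] (x y : R),
      Polynomial.aeval (x + y) u = Polynomial.aeval x u + Polynomial.aeval y u) :
    u = Polynomial.C (u.coeff 1) * Polynomial.X := by
  have h0 : u.coeff 0 = 0 := by
    have := h k 0 0
    simpa [Polynomial.coeff_zero_eq_eval_zero] using this
  -- Additivity at `T + ε` over the dual numbers of `k[T]`, compared with the Taylor expansion,
  -- gives `u' = u'(0)`. So `m uₘ = 0` for `m ≥ 2`, and `m` is invertible when `m < p`.
  let R := TrivSqZeroExt (Polynomial k) (Polynomial k)
  let ι : Polynomial k →ₐ[k] R := TrivSqZeroExt.inlAlgHom k (Polynomial k) (Polynomial k)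
  let ε : R := TrivSqZeroExt.inr 1
  have hε : ε ^ 2 = 0 := by rw [pow_two]; exact TrivSqZeroExt.inr_mul_inr _ 1 1
  have h1 := h R (ι Polynomial.X) ε
  have h2 := Polynomial.aeval_add_of_sq_eq_zero u (ι Polynomial.X) ε hε
  have h3 := Polynomial.aeval_add_of_sq_eq_zero u (ι 0) ε hε
  simp only [Polynomial.aeval_algHom_apply, Polynomial.aeval_X_left_apply] at h1 h2 h3
  have h4 : Polynomial.aeval (0 : Polynomial k) u = 0 := by
    simpa using h (Polynomial k) 0 0
  rw [map_zero, zero_add, h4, map_zero, zero_add] at h3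
  have h5 : ι (Polynomial.derivative u) * ε =
      ι (Polynomial.aeval 0 (Polynomial.derivative u)) * ε := by
    linear_combination h1 - h2 + h3
  have h6 : Polynomial.derivative u = Polynomial.aeval 0 (Polynomial.derivative u) := by
    have hs (v : Polynomial k) : (ι v * ε).snd = v := by
      change (TrivSqZeroExt.inl v * TrivSqZeroExt.inr 1 : R).snd = v
      rw [TrivSqZeroExt.inl_mul_inr, TrivSqZeroExt.snd_inr, smul_eq_mul, mul_one]
    exact (hs _).symm.trans ((congrArg TrivSqZeroExt.snd h5).trans (hs _))
  ext m
  rw [Polynomial.coeff_C_mul, Polynomial.coeff_X]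
  match m with
  | 0 => simp [h0]
  | 1 => simp
  | m + 2 =>
    rw [if_neg (by omega), mul_zero]
    rcases lt_or_ge u.natDegree (m + 2) with hm | hm
    · exact Polynomial.coeff_eq_zero_of_natDegree_lt hm
    have h7 := congrArg (fun v => v.coeff (m + 1)) h6
    have h8 : ((m + 2 : ℕ) : k) ≠ 0 := fun hc =>
      Nat.not_dvd_of_pos_of_lt (by omega) (hm.trans_lt hu) ((CharP.cast_eq_zero_iff k p _).1 hc)
    have h9 : Polynomial.aeval (0 : Polynomial k) (Polynomial.derivative u) =
        Polynomial.C ((Polynomial.derivative u).coeff 0) := by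
      simp [Polynomial.aeval_def, Polynomial.eval₂_at_zero]
    simp only [h9, Polynomial.coeff_C_succ, Polynomial.coeff_derivative] at h7
    refine (mul_eq_zero.1 h7).resolve_right fun hc => h8 ?_
    push_cast at hc ⊢
    linear_combination hc

end Core

/-! ### Additive self-maps of `{F = 0}` are scalar -/

section Rigidity

/-- If `F(u) = c₁ Tᵖ + c₀ T` for polynomials `uᵢ` in one variable `T`, then all `uᵢ` have degree at
most `1`. -/
theorem natDegree_le_one_of_frobLinear {k : Type u} [Field k] {p : ℕ} [Fact p.Prime] {n : ℕ}
    {a l : Fin (n + 1) → k}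
    (hanis : ∀ c : Fin (n + 1) → k, ∑ i, a i * c i ^ p = 0 → c = 0)
    (u : Fin (n + 1) → Polynomial k) {c₁ c₀ : k}
    (h : aeval u (frobLinear p a l) =
      Polynomial.C c₁ * Polynomial.X ^ p + Polynomial.C c₀ * Polynomial.X) (i : Fin (n + 1)) :
    (u i).natDegree ≤ 1 := by
  have hp : 1 < p := (Fact.out : p.Prime).one_lt
  obtain ⟨j, -, hj⟩ := Finset.exists_mem_eq_sup Finset.univ Finset.univ_nonempty
    fun i => (u i).natDegree
  have hle (i) : (u i).natDegree ≤ (u j).natDegree :=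
    hj ▸ Finset.le_sup (f := fun i => (u i).natDegree) (Finset.mem_univ i)
  refine (hle i).trans ?_
  by_contra! hD
  set D := (u j).natDegree with hDdef
  have hpD : D < p * D := lt_mul_of_one_lt_left (by omega) hp
  have hpp : p < p * D := lt_mul_of_one_lt_right (by omega) hD
  -- With `D ≥ 2` the maximal degree, `pD` exceeds both `p` and `D`, so this coefficient is `∑ aᵢ
  -- cᵢᵖ = 0`, where `cᵢ` is the coefficient of `uᵢ` in degree `D`. Anisotropy then kills the
  -- leading coefficient of `u j`.
  have hcoeff := congrArg (fun v => v.coeff (p * D)) h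
  rw [aeval_frobLinear] at hcoeff
  simp only [Polynomial.coeff_add, Polynomial.finsetSum_coeff, Polynomial.algebraMap_eq,
    Polynomial.coeff_C_mul, Polynomial.coeff_pow_of_natDegree_le (hle _),
    Polynomial.coeff_eq_zero_of_natDegree_lt ((hle _).trans_lt hpD), Polynomial.coeff_X_pow,
    Polynomial.coeff_X, if_neg hpp.ne', if_neg (show 1 ≠ p * D by omega), mul_zero,
    Finset.sum_const_zero, add_zero] at hcoeff
  have := congrFun (hanis _ hcoeff) j
  have h0 : u j = 0 := Polynomial.leadingCoeff_eq_zero.1 this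
  rw [hDdef, h0, Polynomial.natDegree_zero] at hD
  omega

variable {k : Type u} [Field k] {p : ℕ} [Fact p.Prime] [CharP k p] {n : ℕ}
  {a l : Fin (n + 1) → k} {f : Fin (n + 1) → MvPolynomial (Fin (n + 1)) k}

/-- Additive polynomials of degree less than `p` in the coordinate `0` that map `{F = 0}` to itself
multiply `F` by a constant. -/
theorem exists_aeval_comp_eq_mul (ha : a 0 ≠ 0) (hf : ∀ i, degreeOf 0 (f i) < p)
    (hadd : ∀ (A : Type u) [CommRing A] [Algebra k A] (y z : Fin (n + 1) → A) (i),
      aeval (y + z) (f i) = aeval y (f i) + aeval z (f i))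
    (hvan : ∀ (A : Type u) [CommRing A] [Algebra k A] (y : Fin (n + 1) → A),
      aeval y (frobLinear p a l) = 0 → aeval (fun i => aeval y (f i)) (frobLinear p a l) = 0) :
    ∃ g : k, ∀ (A : Type u) [CommRing A] [Algebra k A] (y : Fin (n + 1) → A),
      aeval (fun i => aeval y (f i)) (frobLinear p a l) =
        algebraMap k A g * aeval y (frobLinear p a l) := by
  have hp : 1 < p := (Fact.out : p.Prime).one_lt
  let u (i : Fin (n + 1)) : Polynomial k := aeval (lineThrough 0 (0 : Fin (n + 1) → k)) (f i)
  have hline : lineThrough 0 (0 : Fin (n + 1) → k) =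
      Pi.single (M := fun _ => Polynomial k) 0 Polynomial.X := by
    funext i
    simp [lineThrough]
  have hu' (A : Type u) [CommRing A] [Algebra k A] (x : A) (i) :
      Polynomial.aeval x (u i) = aeval (Pi.single (M := fun _ => A) 0 x) (f i) := by
    rw [comp_aeval_apply, hline]
    congr 2
    funext j
    rcases eq_or_ne j 0 with rfl | hj
    · simp
    · simp [hj]
  have hu (i) : u i = Polynomial.C ((u i).coeff 1) * Polynomial.X := by
    refine eq_C_mul_X_of_additive
      ((natDegree_aeval_lineThrough_le _ _ _).trans_lt (hf i)) fun R _ _ x y => ?_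
    rw [hu', hu', hu', Pi.single_add, hadd]
  let α (i : Fin (n + 1)) : k := (u i).coeff 1
  have hα (A : Type u) [CommRing A] [Algebra k A] (x : A) (i) :
      aeval (Pi.single (M := fun _ => A) 0 x) (f i) = algebraMap k A (α i) * x := by
    rw [← hu', hu]
    simp [α]
  -- The only scalar for which the terms of degree `p` in `F ∘ f` and `g F` agree along the line.
  let g : k := (∑ i, a i * α i ^ p) * (a 0)⁻¹
  have hg : (∑ i, a i * α i ^ p) = g * a 0 := by
    simp only [g]
    rw [mul_assoc, inv_mul_cancel₀ ha, mul_one]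
  refine ⟨g, fun A _ _ y => ?_⟩
  let fy : Fin (n + 1) → A := fun i => aeval y (f i)
  have hfl (i) : aeval (lineThrough 0 y) (f i) =
      algebraMap k (Polynomial A) (α i) * Polynomial.X + Polynomial.C (fy i) := by
    rw [lineThrough, hadd, hα, aeval_C_comp]
  -- The difference of `F ∘ f` and `g F` on the line: it is linear, and divisible by the restricted
  -- `F` because `f` preserves `{F = 0}`.
  let q : Polynomial A :=
    Polynomial.C (algebraMap k A (∑ i, l i * α i - g * l 0)) * Polynomial.X +
      Polynomial.C (aeval fy (frobLinear p a l) - algebraMap k A g * aeval y (frobLinear p a l))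
  have hFf : aeval (fun i => aeval (lineThrough 0 y) (f i)) (frobLinear p a l) =
      algebraMap k (Polynomial A) g * aeval (lineThrough 0 y) (frobLinear p a l) + q := by
    have h3 : aeval (lineThrough 0 y) (frobLinear p a l) =
        algebraMap k (Polynomial A) (a 0) * Polynomial.X ^ p +
          algebraMap k (Polynomial A) (l 0) * Polynomial.X +
          Polynomial.C (aeval y (frobLinear p a l)) := by
      rw [lineThrough, (isPPolynomial_frobLinear p a l).aeval_add,
        aeval_single_frobLinear (by omega), aeval_C_comp]
    have h4 : (fun i => aeval (lineThrough 0 y) (f i)) =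
        (fun i => algebraMap k (Polynomial A) (α i) * Polynomial.X) +
          fun i => Polynomial.C (fy i) := funext hfl
    rw [h3, h4, (isPPolynomial_frobLinear p a l).aeval_add, aeval_C_comp, aeval_frobLinear]
    have h1 : ∑ i, algebraMap k (Polynomial A) (a i) *
        (algebraMap k (Polynomial A) (α i) * Polynomial.X) ^ p =
        algebraMap k (Polynomial A) (g * a 0) * Polynomial.X ^ p := by
      rw [← hg, map_sum, Finset.sum_mul]
      exact Finset.sum_congr rfl fun i _ => by rw [map_mul, map_pow]; ring
    have h2 : ∑ i, algebraMap k (Polynomial A) (l i) *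
        (algebraMap k (Polynomial A) (α i) * Polynomial.X) =
        algebraMap k (Polynomial A) (∑ i, l i * α i) * Polynomial.X := by
      rw [map_sum, Finset.sum_mul]
      exact Finset.sum_congr rfl fun i _ => by rw [map_mul]; ring
    rw [h1, h2]
    simp only [q, Polynomial.algebraMap_apply, map_sub, map_mul]
    ring
  have hq : q = 0 := by
    refine eq_zero_of_aeval_lineThrough_dvd ha (l := l) y
      (Polynomial.natDegree_linear_le.trans_lt hp) ?_
    let I := Ideal.span {aeval (lineThrough 0 y) (frobLinear p a l)}
    let π : Polynomial A →ₐ[k] Polynomial A ⧸ I := Ideal.Quotient.mkₐ k I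
    have h0 : π (aeval (lineThrough 0 y) (frobLinear p a l)) = 0 :=
      Ideal.Quotient.eq_zero_iff_mem.2 (Ideal.mem_span_singleton_self _)
    have h1 := hvan _ (fun i => π (lineThrough 0 y i)) (by rw [← comp_aeval_apply, h0])
    simp only [← comp_aeval_apply] at h1 hFf
    rw [hFf, map_add, map_mul, h0, mul_zero, zero_add] at h1
    rw [← Ideal.mem_span_singleton]
    exact Ideal.Quotient.eq_zero_iff_mem.1 h1
  -- The constant term of `q` is the desired identity at `y`.
  have h0 := congrArg (fun v => v.coeff 0) hq
  simp only [q, Polynomial.coeff_add, Polynomial.coeff_C_mul, Polynomial.coeff_X_zero, mul_zero,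
    Polynomial.coeff_C_zero, zero_add, Polynomial.coeff_zero] at h0
  exact sub_eq_zero.1 h0

/-- Additive polynomials of degree less than `p` in the coordinate `0` that map `{F = 0}` to itself
are multiples of the coordinates by a constant in the prime field. -/
theorem exists_eq_C_mul_X (hanis : ∀ c : Fin (n + 1) → k, ∑ i, a i * c i ^ p = 0 → c = 0)
    (hl : l ≠ 0) (hf : ∀ i, degreeOf 0 (f i) < p)
    (hadd : ∀ (A : Type u) [CommRing A] [Algebra k A] (y z : Fin (n + 1) → A) (i),
      aeval (y + z) (f i) = aeval y (f i) + aeval z (f i))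
    (hvan : ∀ (A : Type u) [CommRing A] [Algebra k A] (y : Fin (n + 1) → A),
      aeval y (frobLinear p a l) = 0 → aeval (fun i => aeval y (f i)) (frobLinear p a l) = 0) :
    ∃ g : k, g ^ p = g ∧ ∀ i, f i = C g * X i := by
  have hp : 1 < p := (Fact.out : p.Prime).one_lt
  have hp0 : p ≠ 0 := by omega
  have ha : a 0 ≠ 0 := fun h0 => by
    have := congrFun (hanis (Pi.single 0 1) ?_) 0
    · simp at this
    · rw [Finset.sum_eq_single 0]
      · simp [h0]
      all_goals simp +contextual [hp0]
  obtain ⟨g, hg⟩ := exists_aeval_comp_eq_mul ha hf hadd hvan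
  let e (c : Fin (n + 1) → k) (i : Fin (n + 1)) : k := aeval c (f i)
  let P (c : Fin (n + 1) → k) : k := ∑ i, a i * c i ^ p
  let Λ (c : Fin (n + 1) → k) : k := ∑ i, l i * c i
  have hzero (i) : aeval (0 : Fin (n + 1) → k) (f i) = 0 := by simpa using hadd k 0 0 i
  have hF (c : Fin (n + 1) → k) :
      aeval (fun i => Polynomial.C (c i) * Polynomial.X) (frobLinear p a l) =
        Polynomial.C (P c) * Polynomial.X ^ p + Polynomial.C (Λ c) * Polynomial.X := by
    rw [aeval_frobLinear]
    simp only [P, Λ, map_sum, Finset.sum_mul, map_mul, map_pow, mul_pow, mul_assoc,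
      Polynomial.algebraMap_eq]
  have hline (c : Fin (n + 1) → k) (i) :
      aeval (fun j => Polynomial.C (c j) * Polynomial.X) (f i) =
        Polynomial.C (e c i) * Polynomial.X := by
    set v := aeval (fun j => Polynomial.C (c j) * Polynomial.X) (f i) with hv
    have hev (t : k) : v.eval t = aeval (fun j => c j * t) (f i) := by
      rw [hv, ← Polynomial.coe_aeval_eq_eval]
      change Polynomial.aeval t _ = _
      rw [comp_aeval_apply]
      simp
    have hd : v.natDegree ≤ 1 := by
      refine natDegree_le_one_of_frobLinear (l := l) hanis
        (fun i => aeval (fun j => Polynomial.C (c j) * Polynomial.X) (f i))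
        (c₁ := g * P c) (c₀ := g * Λ c) ?_ i
      rw [hg, hF, Polynomial.algebraMap_eq, map_mul, map_mul]
      ring
    have h1 := Polynomial.eq_X_add_C_of_natDegree_le_one hd
    have h0 : v.coeff 0 = 0 := by
      rw [Polynomial.coeff_zero_eq_eval_zero, hev]
      simpa using hzero i
    rw [h0, map_zero, add_zero] at h1
    have h2 := hev 1
    rw [h1] at h2 ⊢
    simp only [Polynomial.eval_mul, Polynomial.eval_C, Polynomial.eval_X, mul_one] at h2
    rw [h2]
  have hPΛ (c : Fin (n + 1) → k) : P (e c) = g * P c ∧ Λ (e c) = g * Λ c := by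
    have h := hg (Polynomial k) fun i => Polynomial.C (c i) * Polynomial.X
    simp only [hline] at h
    rw [hF, hF, Polynomial.algebraMap_eq] at h
    have h1 := congrArg (fun v => v.coeff p) h
    have h2 := congrArg (fun v => v.coeff 1) h
    simp only [Polynomial.coeff_add, Polynomial.coeff_C_mul, Polynomial.coeff_X_pow,
      Polynomial.coeff_X, if_true, if_neg hp.ne, mul_one, mul_zero, add_zero,
      zero_add] at h1 h2
    exact ⟨h1, h2⟩
  have hiter (m : ℕ) (c : Fin (n + 1) → k) :
      P (e^[m] c) = g ^ m * P c ∧ Λ (e^[m] c) = g ^ m * Λ c := by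
    induction m with
    | zero => simp
    | succ m ih =>
      rw [Function.iterate_succ_apply', (hPΛ _).1, (hPΛ _).2, ih.1, ih.2]
      constructor <;> ring
  have hPinj {c d : Fin (n + 1) → k} (h : P c = P d) : c = d := by
    refine sub_eq_zero.1 (hanis _ ?_)
    simp only [Pi.sub_apply, sub_pow_char, mul_sub, Finset.sum_sub_distrib]
    exact sub_eq_zero.2 h
  have hPsmul (t : k) (c : Fin (n + 1) → k) : P (t • c) = t ^ p * P c := by
    simp only [P, Finset.mul_sum, Pi.smul_apply, smul_eq_mul]
    exact Finset.sum_congr rfl fun i _ => by ring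
  have hΛsmul (t : k) (c : Fin (n + 1) → k) : Λ (t • c) = t * Λ c := by
    simp only [Λ, Finset.mul_sum, Pi.smul_apply, smul_eq_mul]
    exact Finset.sum_congr rfl fun i _ => by ring
  -- Although `g` need not be a `p`-th power a priori, `gᵖ` is one, so `p` iterations of `e` can be
  -- compared with scaling by `g`.
  have hgp : g ^ p = g := by
    obtain ⟨i, hi⟩ := Function.ne_iff.1 hl
    have hΛ : Λ (Pi.single i 1) ≠ 0 := by
      simpa [Λ, Pi.single_apply] using hi
    have h1 : e^[p] (Pi.single i 1) = g • Pi.single i 1 :=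
      hPinj (by rw [hPsmul, (hiter p _).1])
    have h2 := (hiter p (Pi.single i 1)).2
    rw [h1, hΛsmul] at h2
    exact (mul_right_cancel₀ hΛ h2).symm
  have he (c : Fin (n + 1) → k) : e c = g • c := hPinj (by rw [hPsmul, hgp, (hPΛ c).1])
  refine ⟨g, hgp, fun i => ?_⟩
  -- `f i` is its own value at the generic point `X`, which is the sum of its axis components;
  -- additivity reduces to the axes.
  let φ : (Fin (n + 1) → MvPolynomial (Fin (n + 1)) k) →+ MvPolynomial (Fin (n + 1)) k :=
    AddMonoidHom.mk' (fun y => aeval y (f i)) fun y z => hadd _ y z i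
  have hφ (m : Fin (n + 1)) : φ (Pi.single m (X m)) = if i = m then C g * X m else 0 := by
    have h := congrArg (Polynomial.aeval (X m : MvPolynomial (Fin (n + 1)) k))
      (hline (Pi.single m 1) i)
    have hX : (fun j => Polynomial.aeval (X m : MvPolynomial (Fin (n + 1)) k)
        (Polynomial.C ((Pi.single m 1 : Fin (n + 1) → k) j) * Polynomial.X)) =
        Pi.single (M := fun _ => MvPolynomial (Fin (n + 1)) k) m (X m) := by
      funext j
      rcases eq_or_ne j m with rfl | hj
      · simp
      · simp [hj]
    rw [he, comp_aeval_apply, hX] at h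
    refine h.trans ?_
    rcases eq_or_ne i m with rfl | hi
    · simp [algebraMap_eq]
    · simp [hi]
  calc f i = φ X := (aeval_X_left_apply _).symm
    _ = ∑ m, φ (Pi.single m (X m)) := by rw [← map_sum, Finset.univ_sum_single]
    _ = C g * X i := by simp [hφ]

end Rigidity

/-! ### Homogeneous `p`-polynomials -/

section NormalForm

variable {k : Type u} [Field k] {p : ℕ} [Fact p.Prime] {n : ℕ}

/-- A `p`-polynomial that is homogeneous of degree `pᵐ` is of the form `∑ cᵢ Xᵢ ^ pᵐ`. -/
theorem IsPPolynomial.exists_eq_sum_of_isHomogeneous {F : MvPolynomial (Fin n) k}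
    (hF : IsPPolynomial p F) {m : ℕ} (h : F.IsHomogeneous (p ^ m)) :
    ∃ c : Fin n → k, F = ∑ i, C (c i) * X i ^ p ^ m := by
  obtain ⟨N, c, rfl⟩ := hF
  -- The coefficient of `Xᵢ ^ pᵐ` is `0` if `m` is outside the range of summation.
  refine ⟨fun i => if m < N then c i m else 0, ?_⟩
  have h1 := homogeneousComponent_of_mem (m := p ^ m) h
  rw [if_pos rfl, map_sum] at h1
  rw [← h1]
  refine Finset.sum_congr rfl fun i _ => ?_
  have h2 (j : ℕ) : homogeneousComponent (p ^ m) (C (c i j) * X i ^ p ^ j) =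
      if m = j then C (c i m) * X i ^ p ^ m else 0 := by
    have h3 : (C (c i j) * X i ^ p ^ j : MvPolynomial (Fin n) k).IsHomogeneous (p ^ j) :=
      (isHomogeneous_X_pow i _).C_mul _
    rw [homogeneousComponent_of_mem h3]
    rcases eq_or_ne m j with rfl | hmj
    · simp
    · rw [if_neg hmj, if_neg fun he => hmj (Nat.pow_right_injective (Fact.out : p.Prime).two_le he)]
  rw [map_sum, Finset.sum_congr rfl fun j _ => h2 j, Finset.sum_ite_eq]
  split_ifs <;> simp_all

end NormalForm

/-! ### Universality implies anisotropy -/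

section Anisotropic

variable {k : Type u} [Field k] {p : ℕ} [Fact p.Prime] [CharP k p]

/-- The degree of `k` over `kᵖ` is `pʳ`, where `r` is the degree of imperfection. -/
theorem HasDegreeOfImperfection.finrank_eq {r : ℕ} (hk : HasDegreeOfImperfection k p r) :
    Module.finrank (frobenius k p).fieldRange k = p ^ r := by
  obtain ⟨b, hb, hb'⟩ := hk
  rw [Module.finrank_eq_card_basis (Module.Basis.mk hb hb'.ge)]
  simp

/-- A universal form `∑ aᵢ Xᵢᵖ` in `[k : kᵖ]` variables has only the trivial zero. -/
theorem eq_zero_of_sum_mul_pow_eq_zero {n : ℕ} {a : Fin n → k}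
    (hn : Module.finrank (frobenius k p).fieldRange k = n)
    (ha : ∀ y : k, ∃ x : Fin n → k, ∑ i, a i * x i ^ p = y) (c : Fin n → k)
    (hc : ∑ i, a i * c i ^ p = 0) : c = 0 := by
  let ψ (x : k) : (frobenius k p).fieldRange := ⟨x ^ p, x, rfl⟩
  have hψ (x y : k) : ψ x • y = y * x ^ p := mul_comm _ _
  -- Universality makes the `aᵢ` a spanning family over `kᵖ` of cardinality equal to the dimension.
  have hli : LinearIndependent (frobenius k p).fieldRange a := by
    refine linearIndependent_of_top_le_span_of_card_eq_finrank (fun y _ => ?_) (by simp [hn])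
    obtain ⟨x, rfl⟩ := ha y
    refine Submodule.sum_mem _ fun i _ => ?_
    rw [← hψ]
    exact Submodule.smul_mem _ _ (Submodule.subset_span ⟨i, rfl⟩)
  funext i
  have h := Fintype.linearIndependent_iff.1 hli (fun i => ψ (c i)) (by simpa only [hψ] using hc) i
  exact eq_zero_of_pow_eq_zero (congrArg Subtype.val h)

end Anisotropic

/-! ### Division by `F` in the coordinate `0` -/

section Reduction

variable {k : Type u} [Field k] {p : ℕ} [Fact p.Prime] {n : ℕ} {a l : Fin (n + 1) → k}

/-- Modulo `F`, every polynomial has degree less than `p` in the coordinate `0`. -/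
theorem exists_degreeOf_lt_of_frobLinear (ha : a 0 ≠ 0) (f : MvPolynomial (Fin (n + 1)) k) :
    ∃ f', degreeOf 0 f' < p ∧ frobLinear p a l ∣ f - f' := by
  have hp : 1 < p := (Fact.out : p.Prime).one_lt
  let t := finSuccEquiv k n
  -- Chosen so that `F = a₀ (X₀ᵖ + c)`, with `c` of degree at most `1` in `X₀`.
  let c : Polynomial (MvPolynomial (Fin n) k) := Polynomial.C (C (l 0 * (a 0)⁻¹)) * Polynomial.X +
    Polynomial.C (C (a 0)⁻¹ * (∑ i : Fin n, C (a i.succ) * X i ^ p +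
      ∑ i : Fin n, C (l i.succ) * X i))
  let q := Polynomial.X ^ p + c
  have hc : c.natDegree < p := Polynomial.natDegree_linear_le.trans_lt hp
  have hq : q.Monic := Polynomial.monic_X_pow_add
    (Polynomial.degree_linear_le.trans_lt (by exact_mod_cast hp))
  have hqd : q.natDegree = p := by
    rw [Polynomial.natDegree_add_eq_left_of_natDegree_lt, Polynomial.natDegree_X_pow]
    rwa [Polynomial.natDegree_X_pow]
  have ht : t (frobLinear p a l) = Polynomial.C (C (a 0)) * q := by
    have h1 : (Polynomial.C (C (a 0)) * Polynomial.C (C (a 0)⁻¹) :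
        Polynomial (MvPolynomial (Fin n) k)) = 1 := by
      rw [← map_mul, ← map_mul, mul_inv_cancel₀ ha, map_one, map_one]
    have hC (x : k) : t (C x) = Polynomial.C (C x) := by
      simp [t, finSuccEquiv_apply]
    have hX0 : t (X 0) = Polynomial.X := finSuccEquiv_X_zero
    have hXs (i : Fin n) : t (X i.succ) = Polynomial.C (X i) := finSuccEquiv_X_succ
    simp only [frobLinear, Fin.sum_univ_succ, map_add, map_sum, map_mul, map_pow, hC, hX0, hXs,
      q, c]
    linear_combination (-Polynomial.C (C (l 0)) * Polynomial.X -
      ∑ i : Fin n, Polynomial.C (C (a i.succ)) * Polynomial.C (X i) ^ p -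
      ∑ i : Fin n, Polynomial.C (C (l i.succ)) * Polynomial.C (X i)) * h1
  refine ⟨t.symm (t f %ₘ q), ?_, ?_⟩
  · rw [← natDegree_finSuccEquiv, AlgEquiv.apply_symm_apply, ← hqd]
    refine Polynomial.natDegree_modByMonic_lt _ hq fun h => ?_
    rw [h, Polynomial.natDegree_one] at hqd
    omega
  · rw [← map_dvd_iff t, map_sub, AlgEquiv.apply_symm_apply, ht]
    have hu : IsUnit (Polynomial.C (C (a 0)) : Polynomial (MvPolynomial (Fin n) k)) :=
      (ha.isUnit.map C).map Polynomial.C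
    rw [hu.mul_left_dvd]
    exact ⟨t f /ₘ q, by rw [sub_eq_iff_eq_add', Polynomial.modByMonic_add_div]⟩

end Reduction

/-! ### Computation of the endomorphism ring -/

section EndRing

variable {k : Type u} [Field k] {p : ℕ} [Fact p.Prime] [CharP k p] {n : ℕ}

/-- Elements fixed by the Frobenius lie in the prime field. -/
theorem exists_natCast_eq_of_pow_eq {g : k} (hg : g ^ p = g) : ∃ m : ℕ, (m : k) = g := by
  have h := (Subfield.mem_bot_iff_pow_eq_self k p).2 hg
  rw [← ZMod.fieldRange_castHom_eq_bot p] at h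
  obtain ⟨x, rfl⟩ := h
  exact ⟨x.val, by rw [ZMod.castHom_apply, ZMod.natCast_val]⟩

variable {a l : Fin (n + 1) → k}

/-- The endomorphism ring of `{∑ aᵢ Xᵢᵖ + ∑ lᵢ Xᵢ = 0}` is the prime field if `∑ aᵢ Xᵢᵖ` has only the
trivial zero and `l ≠ 0`. -/
theorem nonempty_endRing_affineVanishingGroup_equiv
    (hanis : ∀ c : Fin (n + 1) → k, ∑ i, a i * c i ^ p = 0 → c = 0) (hl : l ≠ 0)
    (hF : IsPPolynomial p (frobLinear p a l)) :
    Nonempty (EndRing (affineVanishingGroup p (frobLinear p a l) hF) ≃+* ZMod p) := by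
  set F := frobLinear p a l
  let E := EndRing (affineVanishingGroup p F hF)
  have hp : 1 < p := (Fact.out : p.Prime).one_lt
  have ha : a 0 ≠ 0 := fun h0 => by
    have := congrFun (hanis (Pi.single 0 1) ?_) 0
    · simp at this
    · rw [Finset.sum_eq_single 0]
      · simp [h0]
      all_goals simp +contextual [(show p ≠ 0 by omega)]
  have hcast (m : ℕ) (i) : (endPoint p F hF (m : E)).1 i =
      Ideal.Quotient.mk (Ideal.span {F}) (C (m : k) * X i) := by
    rw [← nsmul_one m, map_nsmul]
    change m • (endPoint p F hF 1).1 i = _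
    rw [endPoint_one, ← map_nsmul, nsmul_eq_mul, map_natCast]
  have hp0 : ((p : ℕ) : E) = 0 := endPoint_injective p F hF <| Subtype.ext <| funext fun i => by
    rw [hcast, CharP.cast_eq_zero, C_0, zero_mul, map_zero, map_zero]
    rfl
  -- Otherwise `F` divides `X₀`, whose degree in `X₀` is less than `p`.
  have hone : (1 : E) ≠ 0 := fun h => by
    have h1 := congrArg (fun x => (endPoint p F hF x).1 0) h
    simp only [endPoint_one, map_zero] at h1
    have h2 : F ∣ X 0 := Ideal.mem_span_singleton.1 (Ideal.Quotient.eq_zero_iff_mem.1 h1)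
    have h3 := map_dvd (aeval (lineThrough 0 (0 : Fin (n + 1) → k))) h2
    have h4 : aeval (lineThrough 0 (0 : Fin (n + 1) → k)) (X 0 : MvPolynomial (Fin (n + 1)) k) =
        Polynomial.X := by
      simp [lineThrough]
    rw [h4] at h3
    exact Polynomial.X_ne_zero (eq_zero_of_aeval_lineThrough_dvd ha (l := l) (p := p) 0
      (by rwa [Polynomial.natDegree_X]) h3)
  have : Nontrivial E := ⟨1, 0, hone⟩
  have : CharP E p := (CharP.charP_iff_prime_eq_zero Fact.out).2 hp0
  refine ⟨(RingEquiv.ofBijective (ZMod.castHom dvd_rfl E) ⟨RingHom.injective _, fun e => ?_⟩).symm⟩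
  choose g hg using fun i => Ideal.Quotient.mk_surjective ((endPoint p F hF e).1 i)
  choose f hf hfg using fun i => exists_degreeOf_lt_of_frobLinear (p := p) (l := l) ha (g i)
  have hef (i) : (endPoint p F hF e).1 i = Ideal.Quotient.mk (Ideal.span {F}) (f i) := by
    rw [← hg]
    exact Ideal.Quotient.eq.2 (Ideal.mem_span_singleton.2 (hfg i))
  have hadd (A : Type u) [CommRing A] [Algebra k A] (y z : Fin (n + 1) → A) (i) :
      aeval (y + z) (f i) = aeval y (f i) + aeval z (f i) := by
    -- One summand is freed from `{F = 0}` at a time; the two uses leave only the case of two points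
    -- of `{F = 0}`.
    refine aeval_add_of_vanishing ha (l := l) (hf i) z (fun R _ _ φ y hy => ?_) y
    rw [add_comm y, add_comm (aeval y (f i))]
    refine aeval_add_of_vanishing ha (l := l) (hf i) y (fun S _ _ χ x hx => ?_) _
    refine endPoint_add p F hF e hef hx ?_ i
    rw [← comp_aeval_apply, hy, map_zero]
  have hvan (A : Type u) [CommRing A] [Algebra k A] (y : Fin (n + 1) → A)
      (hy : aeval y F = 0) : aeval (fun i => aeval y (f i)) F = 0 := by
    have h := (homPoint p F hF (pointHom p F hF ⟨y, hy⟩ ≫ (Additive.toMul e).hom.hom)).2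
    have h' := funext (homPoint_comp p F hF e hef ⟨y, hy⟩)
    exact (congrArg (fun v => aeval v F) h').symm.trans h
  obtain ⟨c, hcp, hc⟩ := exists_eq_C_mul_X hanis hl hf hadd hvan
  obtain ⟨m, rfl⟩ := exists_natCast_eq_of_pow_eq hcp
  refine ⟨m, ?_⟩
  rw [map_natCast]
  exact endPoint_injective p F hF <| Subtype.ext <| funext fun i => by rw [hcast, hef, hc]

end EndRing

/-! ### The main theorem -/

theorem mainTheorem9 {k : Type u} [Field k] (p : ℕ) [Fact p.Prime] [CharP k p]
    (r : ℕ) (hr : 0 < r) (hk : HasDegreeOfImperfection k p r)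
    (P L : MvPolynomial (Fin (p ^ r)) k)
    (hP : IsPPolynomial p P) (hP_hom : P.IsHomogeneous p) (hP_univ : IsUniversal P)
    (hL : IsPPolynomial p L) (hL_hom : L.IsHomogeneous 1) (hL_ne : L ≠ 0) :
    Nonempty (EndRing (groupV p P L hP hL) ≃+* ZMod p) := by
  have hn := hk.finrank_eq
  obtain ⟨n, hpr⟩ := Nat.exists_eq_add_one_of_ne_zero (pow_pos (Fact.out : p.Prime).pos r).ne'
  -- Only `N = [k : kᵖ]` and `N = n + 1` matter from here on; the latter provides the coordinate
  -- `0`.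
  generalize p ^ r = N at *
  subst hpr
  obtain ⟨a, ha⟩ := hP.exists_eq_sum_of_isHomogeneous (m := 1) (by rwa [pow_one])
  obtain ⟨l, hl⟩ := hL.exists_eq_sum_of_isHomogeneous (m := 0) (by rwa [pow_zero])
  simp only [pow_one, pow_zero] at ha hl
  have hPL : P + L = frobLinear p a l := by rw [ha, hl, frobLinear]
  have hl0 : l ≠ 0 := by
    rintro rfl
    exact hL_ne (by simp [hl])
  have hanis := eq_zero_of_sum_mul_pow_eq_zero (p := p) (a := a) hn fun y => by
    obtain ⟨x, hx⟩ := hP_univ y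
    exact ⟨x, by simpa [ha] using hx⟩
  -- The group depends on `F` and on the proof `hF`, so the normal form is substituted for a
  -- variable `F`.
  have key : ∀ (F : MvPolynomial (Fin (n + 1)) k) (hF : IsPPolynomial p F),
      F = frobLinear p a l → Nonempty (EndRing (vanishingGroup p F hF) ≃+* ZMod p) := by
    rintro F hF rfl
    obtain ⟨e⟩ := nonempty_endRing_affineVanishingGroup_equiv hanis hl0 hF
    exact ⟨(EndRing.mapEquiv (specFunctor k) (algSpec.fullyFaithful (R := .of k)) _).symm.trans e⟩
  exact key _ _ hPL
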